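/- Let $X$ be a real Banach lattice. Call $x \in X$ \emph{order continuous} if $\|x_n\| \to 0$ for every sequence $(x_n)$ in $X$ with $0 \le x_n \le |x|$ and $x_n \downarrow 0$, and let $X_a$ be the set of all order continuous elements of $X$. For $A \subseteq X$ put $A^d = \{x \in X : |x| \wedge |y| = 0 \text{ for all } y \in A\}$. Suppose that (i) $X$ is super $\sigma$-Dedekind complete: every nonempty countable subset of $X$ that is bounded above has a supremum, and every nonempty subset of $X$ that has a supremum contains an at most countable subset with the same supremum; (ii) $X$ has the semi-Fatou property: if $0 \le x_n \uparrow x$ in $X$, then $\|x_n\| \to \|x\|$; (iii) $(X_a^d)^d = X$. Then $X$ contains a lattice isometric copy of $\ell_\infty$ (that is, there is a linear isometry $T \colon \ell_\infty \to X$, not necessarily onto, that preserves the lattice operations) if and only if there is a nonzero singular functional on $X$ that attains its norm, that is, some $S \in X^*$ with $S \neq 0$, $S(x) = 0$ for all $x \in X_a$, and $S(f) = \|S\|$ for some $f \in X$ with $\|f\| \le 1$. -/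

import Mathlib

open Filter Topology
open scoped ENNReal

namespace BanachLattice

section Order

variable (X : Type*) [Lattice X]

/-- Every nonempty countable subset that is bounded above has a supremum. -/
def IsSigmaDedekindComplete : Prop :=
  ∀ A : Set X, A.Nonempty → A.Countable → BddAbove A → ∃ x : X, IsLUB A x

/-- `X` is σ-Dedekind complete, and every nonempty subset that has a supremum contains an at most
countable subset with the same supremum. -/
def IsSuperSigmaDedekindComplete : Prop :=
  IsSigmaDedekindComplete X ∧
    ∀ (A : Set X) (x : X), A.Nonempty → IsLUB A x → ∃ C ⊆ A, C.Countable ∧ IsLUB C x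

end Order

/-- The disjoint complement `A^d`: all elements disjoint from every element of `A`. -/
def disjointComplement {X : Type*} [Lattice X] [AddCommGroup X] (A : Set X) : Set X :=
  {x | ∀ y ∈ A, |x| ⊓ |y| = 0}

section Norm

variable (X : Type*) [NormedAddCommGroup X] [Lattice X]

/-- If `0 ≤ u n ↑ x` in `X`, then `‖u n‖ → ‖x‖`. -/
def HasSemiFatouProperty : Prop :=
  ∀ (u : ℕ → X) (x : X), (∀ n, 0 ≤ u n) → Monotone u → IsLUB (Set.range u) x →
    Tendsto (fun n => ‖u n‖) atTop (𝓝 ‖x‖)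

variable {X} in
/-- `x` has order continuous norm: `‖u n‖ → 0` whenever `0 ≤ u n ≤ |x|` and `u n ↓ 0`. -/
def IsOrderContinuousElement (x : X) : Prop :=
  ∀ u : ℕ → X, (∀ n, 0 ≤ u n ∧ u n ≤ |x|) → Antitone u → IsGLB (Set.range u) 0 →
    Tendsto (fun n => ‖u n‖) atTop (𝓝 0)

/-- `X_a`, the set of all order continuous elements of `X`. -/
def orderContinuousPart : Set X := {x | IsOrderContinuousElement x}

variable [NormedSpace ℝ X]

/-- There is a linear isometry of `ℓ_∞` into `X` that preserves the lattice operations, those of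
`ℓ_∞` being the coordinatewise ones. -/
def ContainsLatticeIsometricCopyOfEllInfty : Prop :=
  ∃ T : lp (fun _ : ℕ => ℝ) ∞ →ₗᵢ[ℝ] X, ∀ a b c : lp (fun _ : ℕ => ℝ) ∞,
    ((∀ n, c n = max (a n) (b n)) → T c = T a ⊔ T b) ∧
    ((∀ n, c n = min (a n) (b n)) → T c = T a ⊓ T b)

variable {X}

/-- A continuous linear functional is singular if it vanishes on `X_a`. -/
def IsSingularFunctional (S : StrongDual ℝ X) : Prop :=
  ∀ x ∈ orderContinuousPart X, S x = 0

end Norm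

/-- `S` attains its norm on the closed unit ball. -/
def AttainsNorm {X : Type*} [NormedAddCommGroup X] [NormedSpace ℝ X] (S : StrongDual ℝ X) :
    Prop :=
  ∃ x : X, ‖x‖ ≤ 1 ∧ S x = ‖S‖

end BanachLattice

set_option linter.unusedSectionVars false

namespace BanachLattice

/-! ### Disjointness in lattice-ordered groups. -/

section Group

variable {G : Type*} [AddCommGroup G] [Lattice G] [IsOrderedAddMonoid G]

/-! A copy of `ℓ_∞` carries disjoint unit vectors below the image `f` of the constant sequence `1`.
Disjoint sequences below an order continuous `y` are norm null, so `‖f - y‖ ≥ 1` for every such `y`,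
and Hahn–Banach on the quotient by `X_a` gives a singular functional attaining its norm at `f`.

Conversely, let a nonzero singular `S` attain its norm at `f`. Subtracting an order continuous `0 ≤
u ≤ |f|` leaves norm one (`norm_abs_sub_eq_one`). By (iii) and super σ-Dedekind completeness, `|f|`
is the supremum of an increasing sequence of such elements; band projections turn them into
components `u n` of `|f|` (`exists_components`). Differences of components along a subsequence are
disjoint, and the semi-Fatou property lets their norms tend to `‖|f| - u n‖ = 1`
(`exists_disjointSeq`). Such a sequence, bounded by `|f|`, spans `ℓ_∞` through order sums in which
every coordinate is repeated infinitely often (`containsCopy_of_disjointSeq`). -/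

lemma le_of_le_of_sub_eq {a b c d : G} (h : c ≤ d) (e : b - a = d - c) : a ≤ b := by
  rw [← sub_nonneg, e]; exact sub_nonneg.2 h

lemma inf_add_le {a b c : G} (ha : 0 ≤ a) (hb : 0 ≤ b) (hc : 0 ≤ c) :
    a ⊓ (b + c) ≤ a ⊓ b + a ⊓ c := by
  rw [inf_add, add_inf, add_inf]
  refine le_inf (le_inf ?_ ?_) (le_inf ?_ inf_le_right)
  · exact inf_le_left.trans (le_add_of_nonneg_left ha)
  · exact inf_le_left.trans (le_add_of_nonneg_right hc)
  · exact inf_le_left.trans (le_add_of_nonneg_left hb)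

lemma disjoint_add {a b c : G} (ha : 0 ≤ a) (hb : 0 ≤ b) (hc : 0 ≤ c)
    (hab : a ⊓ b = 0) (hac : a ⊓ c = 0) : a ⊓ (b + c) = 0 :=
  le_antisymm (by simpa [hab, hac] using inf_add_le ha hb hc) (le_inf ha (add_nonneg hb hc))

lemma disjoint_mono {a b c d : G} (ha : 0 ≤ a) (hb : 0 ≤ b) (hac : a ≤ c) (hbd : b ≤ d)
    (h : c ⊓ d = 0) : a ⊓ b = 0 :=
  le_antisymm (h ▸ inf_le_inf hac hbd) (le_inf ha hb)

lemma add_eq_sup_of_disjoint {a b : G} (h : a ⊓ b = 0) : a + b = a ⊔ b := by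
  rw [← inf_add_sup, h, zero_add]

lemma inf_sub_inf_le {a b : G} (h : b ≤ a) (c : G) : c ⊓ a - c ⊓ b ≤ a - b := by
  have := (le_abs_self _).trans (abs_inf_sub_inf_le_abs a b c)
  rwa [abs_of_nonneg (sub_nonneg.2 h), inf_comm a, inf_comm b] at this

lemma abs_add_of_disjoint {a b : G} (h : |a| ⊓ |b| = 0) : |a + b| = |a| + |b| := by
  refine le_antisymm (abs_add_le a b) ?_
  rw [add_eq_sup_of_disjoint h]
  have key : ∀ a b : G, |a| ⊓ |b| = 0 → |a| ≤ |a + b| := fun a b h => by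
    have h1 : |a| ≤ |a + b| + |b| := by
      simpa using abs_add_le (a + b) (-b)
    have h2 : |a| ⊓ |a| ≤ |a| ⊓ |a + b| + |a| ⊓ |b| :=
      (inf_le_inf_left _ h1).trans (inf_add_le (abs_nonneg _) (abs_nonneg _) (abs_nonneg _))
    rw [h, add_zero, inf_idem] at h2
    exact h2.trans inf_le_right
  refine sup_le (key a b h) ?_
  rw [add_comm]
  exact key b a (by rwa [inf_comm])

/-- The sequence `d` consists of positive, pairwise disjoint elements. -/
structure DisjointSeq (d : ℕ → G) : Prop where
  nonneg : ∀ n, 0 ≤ d n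
  disj : ∀ m n, m < n → d m ⊓ d n = 0

lemma DisjointSeq.sum_nonneg {d : ℕ → G} (hd : DisjointSeq d) (N : ℕ) :
    0 ≤ ∑ n ∈ Finset.range N, d n := Finset.sum_nonneg fun n _ => hd.nonneg n

lemma DisjointSeq.sum_mono {d : ℕ → G} (hd : DisjointSeq d) :
    Monotone fun N => ∑ n ∈ Finset.range N, d n :=
  monotone_nat_of_le_succ fun n => by
    rw [Finset.sum_range_succ]; exact le_add_of_nonneg_right (hd.nonneg n)

lemma DisjointSeq.sum_disj {d : ℕ → G} (hd : DisjointSeq d) (N m : ℕ) (h : N ≤ m) :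
    d m ⊓ ∑ n ∈ Finset.range N, d n = 0 := by
  induction N with
  | zero => simpa using hd.nonneg m
  | succ N ih =>
    rw [Finset.sum_range_succ]
    refine disjoint_add (hd.nonneg m) (hd.sum_nonneg N) (hd.nonneg N) (ih (by omega)) ?_
    rw [inf_comm]; exact hd.disj N m (by omega)

lemma DisjointSeq.sum_le {d : ℕ → G} (hd : DisjointSeq d) {x : G} (hx : 0 ≤ x)
    (h : ∀ n, d n ≤ x) (N : ℕ) : ∑ n ∈ Finset.range N, d n ≤ x := by
  induction N with
  | zero => simpa using hx
  | succ N ih =>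
    rw [Finset.sum_range_succ, add_eq_sup_of_disjoint (by rw [inf_comm]; exact hd.sum_disj N N le_rfl)]
    exact sup_le ih (h N)

lemma exists_isLUB_of_isSigmaDedekindComplete (h : IsSigmaDedekindComplete G) (u : ℕ → G) (x : G)
    (hu : ∀ n, u n ≤ x) : ∃ s, IsLUB (Set.range u) s :=
  h _ (Set.range_nonempty u) (Set.countable_range u) ⟨x, by rintro _ ⟨n, rfl⟩; exact hu n⟩

lemma isLUB_range_sub {u : ℕ → G} {s : G} (h : IsLUB (Set.range u) s) :
    IsGLB (Set.range fun n => s - u n) 0 := by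
  constructor
  · rintro _ ⟨n, rfl⟩
    exact sub_nonneg.2 (h.1 ⟨n, rfl⟩)
  · intro z hz
    have : s ≤ s - z := h.2 (by
      rintro _ ⟨n, rfl⟩
      have h1 : z ≤ s - u n := hz ⟨n, rfl⟩
      exact le_of_le_of_sub_eq h1 (by abel))
    exact le_of_le_of_sub_eq this (by abel)

end Group

/-! ### Scalars, and an Archimedean limit argument. -/

section Module

variable {X : Type*} [AddCommGroup X] [Lattice X] [IsOrderedAddMonoid X] [Module ℝ X]
  [IsOrderedModule ℝ X]

lemma smul_inf_of_pos {c : ℝ} (hc : 0 < c) (a b : X) : c • (a ⊓ b) = c • a ⊓ c • b :=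
  (OrderIso.smulRight hc).map_inf a b

lemma abs_smul_eq (c : ℝ) (x : X) : |c • x| = |c| • |x| := by
  have key : ∀ c : ℝ, 0 ≤ c → |c • x| = c • |x| := fun c hc => by
    rcases hc.eq_or_lt with rfl | hc
    · simp
    · rw [abs, abs, ← smul_neg]
      exact ((OrderIso.smulRight hc).map_sup x (-x)).symm
  rcases le_total 0 c with hc | hc
  · rw [key c hc, abs_of_nonneg hc]
  · have := key (-c) (by linarith)
    rwa [neg_smul, abs_neg, ← abs_of_nonpos hc] at this

lemma smul_le_of_le_one {c : ℝ} (hc : c ≤ 1) {x : X} (hx : 0 ≤ x) : c • x ≤ x := by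
  simpa using smul_le_smul_of_nonneg_right hc hx

lemma disjoint_smul {a b : X} (ha : 0 ≤ a) (hb : 0 ≤ b) (h : a ⊓ b = 0) {c : ℝ} (hc : 0 ≤ c) :
    (c • a) ⊓ b = 0 := by
  refine disjoint_mono (smul_nonneg hc ha) hb
    (smul_le_smul_of_nonneg_right (le_max_left c 1) ha) (d := max c 1 • b) ?_ ?_
  · simpa using smul_le_smul_of_nonneg_right (le_max_right c 1) hb
  · rw [← smul_inf_of_pos (by positivity), h, smul_zero]

lemma le_add_of_isGLB {r : ℕ → X} (hr : IsGLB (Set.range r) 0) {c : ℝ} (hc : 0 ≤ c) {a b : X}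
    (h : ∀ n, a ≤ b + c • r n) : a ≤ b := by
  rcases hc.eq_or_lt with rfl | hc
  · simpa using h 0
  · have : c⁻¹ • (a - b) ≤ 0 := hr.2 (by
      rintro _ ⟨n, rfl⟩
      rw [inv_smul_le_iff_of_pos hc]
      exact sub_le_iff_le_add'.2 (h n))
    rw [inv_smul_le_iff_of_pos hc, smul_zero] at this
    exact sub_nonpos.1 this

end Module

/-! ### The ideal of order continuous elements. -/

section Ideal

variable {X : Type*} [NormedAddCommGroup X] [Lattice X] [IsOrderedAddMonoid X] [HasSolidNorm X]

lemma norm_le_norm_of_nonneg_of_le {a b : X} (ha : 0 ≤ a) (h : a ≤ b) : ‖a‖ ≤ ‖b‖ :=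
  norm_le_norm_of_abs_le_abs (by rwa [abs_of_nonneg ha, abs_of_nonneg (ha.trans h)])

lemma IsOrderContinuousElement.mono {x y : X} (hx : IsOrderContinuousElement x) (h : |y| ≤ |x|) :
    IsOrderContinuousElement y :=
  fun u hu => hx u fun n => ⟨(hu n).1, (hu n).2.trans h⟩

lemma isGLB_zero_of_le {u v : ℕ → X} (hu : IsGLB (Set.range u) 0) (hv : ∀ n, 0 ≤ v n)
    (h : ∀ n, v n ≤ u n) : IsGLB (Set.range v) 0 :=
  ⟨by rintro _ ⟨n, rfl⟩; exact hv n, fun z hz => hu.2 (by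
    rintro _ ⟨n, rfl⟩; exact (hz ⟨n, rfl⟩).trans (h n))⟩

/-- Riesz decomposition: `u n` splits into `u n ⊓ |x|` and `(u n - |x|)⁺ ≤ |y|`, both decreasing to
`0`. -/
lemma IsOrderContinuousElement.add {x y : X} (hx : IsOrderContinuousElement x)
    (hy : IsOrderContinuousElement y) : IsOrderContinuousElement (x + y) := by
  intro u hu hmono hinf
  have h1 := hx (fun n => u n ⊓ |x|) (fun n => ⟨le_inf (hu n).1 (abs_nonneg x), inf_le_right⟩)
    (fun m n h => inf_le_inf_right _ (hmono h))
    (isGLB_zero_of_le hinf (fun n => le_inf (hu n).1 (abs_nonneg x)) fun n => inf_le_left)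
  have heq : ∀ n, u n - u n ⊓ |x| = (u n - |x|) ⊔ 0 := fun n => by
    rw [sub_inf, sub_self, sup_comm]
  have h2 := hy (fun n => u n - u n ⊓ |x|) (fun n => ⟨sub_nonneg.2 inf_le_left, by
      rw [heq]
      exact sup_le (sub_le_iff_le_add'.2 ((hu n).2.trans (abs_add_le x y))) (abs_nonneg y)⟩)
    (fun m n h => by
      simp only [heq]
      exact sup_le_sup_right (sub_le_sub_right (hmono h) _) _)
    (isGLB_zero_of_le hinf (fun n => sub_nonneg.2 inf_le_left)
      fun n => sub_le_self _ (le_inf (hu n).1 (abs_nonneg x)))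
  have h3 := h1.add h2
  rw [add_zero] at h3
  exact squeeze_zero (fun n => norm_nonneg _) (fun n => by
    simpa using norm_add_le (u n ⊓ |x|) (u n - u n ⊓ |x|)) h3

lemma IsOrderContinuousElement.smul [NormedSpace ℝ X] [IsOrderedModule ℝ X] {x : X}
    (hx : IsOrderContinuousElement x) (c : ℝ) : IsOrderContinuousElement (c • x) := by
  intro u hu hmono hinf
  -- Using `|c| + 1` rather than `|c|` covers `c = 0` and makes the factor at most `1`.
  have hc : 0 < (|c| + 1)⁻¹ := by positivity
  have hle : ∀ n, (|c| + 1)⁻¹ • u n ≤ |x| := fun n => by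
    rw [inv_smul_le_iff_of_pos (by positivity)]
    refine (hu n).2.trans ?_
    rw [abs_smul_eq]
    exact smul_le_smul_of_nonneg_right (by linarith) (abs_nonneg x)
  have h1 := hx (fun n => (|c| + 1)⁻¹ • u n)
    (fun n => ⟨smul_nonneg hc.le (hu n).1, hle n⟩)
    (fun m n h => smul_le_smul_of_nonneg_left (hmono h) hc.le)
    (isGLB_zero_of_le hinf (fun n => smul_nonneg hc.le (hu n).1) fun n =>
      smul_le_of_le_one (inv_le_one_of_one_le₀ (by linarith [abs_nonneg c])) (hu n).1)
  have h2 := h1.const_mul (|c| + 1)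
  rw [mul_zero] at h2
  refine h2.congr fun n => ?_
  rw [norm_smul, Real.norm_of_nonneg hc.le]
  field_simp

lemma isOrderContinuousElement_zero : IsOrderContinuousElement (0 : X) := by
  intro u hu _ _
  have : ∀ n, u n = 0 := fun n => le_antisymm (by simpa using (hu n).2) (hu n).1
  simp [this]

/-- The ideal `X_a` as a subspace. -/
def orderContinuousSubmodule (X : Type*) [NormedAddCommGroup X] [Lattice X] [IsOrderedAddMonoid X]
    [HasSolidNorm X] [NormedSpace ℝ X] [IsOrderedModule ℝ X] : Submodule ℝ X where
  carrier := orderContinuousPart X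
  add_mem' hx hy := IsOrderContinuousElement.add hx hy
  zero_mem' := isOrderContinuousElement_zero
  smul_mem' c _ hx := IsOrderContinuousElement.smul hx c

/-- A disjoint sequence below an order continuous element is norm null. -/
lemma DisjointSeq.tendsto_norm {d : ℕ → X} (hd : DisjointSeq d) (hX : IsSigmaDedekindComplete X)
    {y : X} (hy : IsOrderContinuousElement y) (h : ∀ n, d n ≤ |y|) :
    Tendsto (fun n => ‖d n‖) atTop (𝓝 0) := by
  have hle := hd.sum_le (abs_nonneg y) h
  -- The remainders of the order sum `s` decrease to `0` below `|y|`, and each dominates the next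
  -- term of `d`.
  obtain ⟨s, hs⟩ := exists_isLUB_of_isSigmaDedekindComplete hX _ _ hle
  have hpos : ∀ N, 0 ≤ s - ∑ n ∈ Finset.range N, d n := fun N => sub_nonneg.2 (hs.1 ⟨N, rfl⟩)
  have hsy : s ≤ |y| := hs.2 (by rintro _ ⟨N, rfl⟩; exact hle N)
  have := hy (fun N => s - ∑ n ∈ Finset.range N, d n)
    (fun N => ⟨hpos N, (sub_le_self _ (hd.sum_nonneg N)).trans hsy⟩)
    (fun m n h => sub_le_sub_left (hd.sum_mono h) _) (isLUB_range_sub hs)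
  refine squeeze_zero (fun n => norm_nonneg _) (fun n => ?_) this
  refine norm_le_norm_of_nonneg_of_le (hd.nonneg n) ?_
  have h1 : ∑ k ∈ Finset.range (n + 1), d k ≤ s := hs.1 ⟨n + 1, rfl⟩
  rw [Finset.sum_range_succ] at h1
  exact le_of_le_of_sub_eq h1 (by abel)

end Ideal

/-! ### From a copy of `ℓ_∞` to a singular functional. -/

section Forward

variable {X : Type*} [NormedAddCommGroup X] [NormedSpace ℝ X] [Lattice X] [IsOrderedAddMonoid X]
  [IsOrderedModule ℝ X] [HasSolidNorm X]

/-- A unit vector at distance one from `X_a` is normed by a singular functional. -/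
lemma exists_singular_attainsNorm {f : X} (hf : ‖f‖ = 1)
    (h : ∀ y : X, IsOrderContinuousElement y → 1 ≤ ‖f - y‖) :
    ∃ S : StrongDual ℝ X, S ≠ 0 ∧ IsSingularFunctional S ∧ AttainsNorm S := by
  set M := orderContinuousSubmodule X
  have hM : 1 ≤ ‖(Submodule.Quotient.mk f : X ⧸ M)‖ := by
    by_contra! hlt
    obtain ⟨m, hm, hm'⟩ := Submodule.Quotient.norm_mk_lt (Submodule.Quotient.mk f : X ⧸ M)
      (sub_pos.2 hlt)
    have hfm : f - m ∈ M := (Submodule.Quotient.eq M).1 hm.symm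
    have := h _ hfm
    rw [sub_sub_cancel] at this
    linarith
  have hM' : ‖(Submodule.Quotient.mk f : X ⧸ M)‖ = 1 :=
    le_antisymm (hf ▸ Submodule.Quotient.norm_mk_le M f) hM
  obtain ⟨g, hg, hgf⟩ := exists_dual_vector ℝ (Submodule.Quotient.mk f : X ⧸ M) (by simp [hM'])
  let S : StrongDual ℝ X := LinearMap.mkContinuous (g.toLinearMap ∘ₗ M.mkQ) 1 fun x => by
    refine (g.le_opNorm _).trans ?_
    rw [hg]
    gcongr
    exact Submodule.Quotient.norm_mk_le M x
  have hSf : S f = 1 := by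
    change g (Submodule.Quotient.mk f) = 1
    rw [hgf, hM']; rfl
  have hS : ‖S‖ ≤ 1 := LinearMap.mkContinuous_norm_le _ zero_le_one _
  have hS' : 1 ≤ ‖S‖ := by
    have := S.le_opNorm f
    rwa [hSf, hf, norm_one, mul_one] at this
  refine ⟨S, fun h0 => by simp [h0] at hSf, fun x hx => ?_, f, hf.le, hSf.trans (le_antisymm hS' hS)⟩
  have h0 : (Submodule.Quotient.mk x : X ⧸ M) = 0 := (Submodule.Quotient.mk_eq_zero M).2 hx
  change g (Submodule.Quotient.mk x) = 0
  rw [h0, map_zero]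

lemma exists_singular_of_containsCopy (hX : IsSigmaDedekindComplete X)
    (h : ContainsLatticeIsometricCopyOfEllInfty X) :
    ∃ S : StrongDual ℝ X, S ≠ 0 ∧ IsSingularFunctional S ∧ AttainsNorm S := by
  obtain ⟨T, hT⟩ := h
  let one : lp (fun _ : ℕ => ℝ) ∞ := ⟨fun _ => 1, memℓp_infty ⟨1, by rintro _ ⟨n, rfl⟩; simp⟩⟩
  have hone : ∀ n, one n = 1 := fun n => rfl
  let e : ℕ → lp (fun _ : ℕ => ℝ) ∞ := fun n => lp.single ∞ n (1 : ℝ)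
  have he : ∀ n m, e n m = if m = n then 1 else 0 := fun n m => by
    simp [e, lp.single_apply, Pi.single_apply]
  have hnorm : ∀ n, ‖T (e n)‖ = 1 := fun n => by
    rw [T.norm_map, lp.norm_single (by simp)]; simp
  have hd : DisjointSeq fun n => T (e n) := by
    constructor
    · intro n
      have := (hT (e n) 0 (e n)).1 fun m => by
        simp only [he, lp.coeFn_zero, Pi.zero_apply]; split_ifs <;> simp
      rw [map_zero] at this
      rw [this]; exact le_sup_right
    · intro m n hmn
      have := (hT (e m) (e n) 0).2 fun k => by
        simp only [he, lp.coeFn_zero, Pi.zero_apply]; split_ifs <;> first | omega | simp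
      rw [← this, map_zero]
  have hle : ∀ n, T (e n) ≤ T one := fun n => by
    have := (hT (e n) one (e n)).2 fun m => by
      simp only [he, hone]; split_ifs <;> simp
    rw [this]; exact inf_le_right
  have hf : ‖T one‖ = 1 := by
    rw [T.norm_map]
    refine le_antisymm (lp.norm_le_of_forall_le zero_le_one fun n => by simp [hone]) ?_
    simpa [hone] using lp.norm_apply_le_norm (by simp) one 0
  refine exists_singular_attainsNorm hf fun y hy => ?_
  have hd' : DisjointSeq fun n => T (e n) ⊓ |y| :=
    ⟨fun n => le_inf (hd.nonneg n) (abs_nonneg y), fun m n hmn =>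
      disjoint_mono (le_inf (hd.nonneg m) (abs_nonneg y)) (le_inf (hd.nonneg n) (abs_nonneg y))
        inf_le_left inf_le_left (hd.disj m n hmn)⟩
  have hlim := hd'.tendsto_norm hX hy fun n => inf_le_right
  have hlim' := hlim.const_sub 1
  rw [sub_zero] at hlim'
  refine le_of_tendsto' hlim' fun n => ?_
  -- The left side is `(T (e n) - |y|)⁺`, which lies below `|T one - y|`.
  have h1 : ‖T (e n) - T (e n) ⊓ |y|‖ ≤ ‖T one - y‖ := by
    refine norm_le_norm_of_abs_le_abs ?_
    rw [abs_of_nonneg (sub_nonneg.2 inf_le_left), sub_inf, sub_self]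
    refine sup_le (abs_nonneg _) ((sub_le_sub (hle n) (le_abs_self y)).trans (le_abs_self _))
  have h2 := norm_sub_norm_le (T (e n)) (T (e n) ⊓ |y|)
  rw [hnorm] at h2
  exact h2.trans h1

end Forward

/-! ### Order sums along a disjoint sequence. -/

section OrderSum

variable {X : Type*} [AddCommGroup X] [Lattice X] [IsOrderedAddMonoid X] [Module ℝ X]
  [IsOrderedModule ℝ X]

/-- `y` is the order sum of `∑ a n • d n`, relatively to the remainders of `e = ∑ d n`. -/
def IsOrderSum (d : ℕ → X) (e : X) (a : ℕ → ℝ) (y : X) : Prop :=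
  ∃ C : ℝ, 0 ≤ C ∧ ∀ N, |y - ∑ n ∈ Finset.range N, a n • d n| ≤
    C • (e - ∑ n ∈ Finset.range N, d n)

lemma IsOrderSum.add {d : ℕ → X} {e : X} {a b : ℕ → ℝ} {y z : X} (hy : IsOrderSum d e a y)
    (hz : IsOrderSum d e b z) : IsOrderSum d e (fun n => a n + b n) (y + z) := by
  obtain ⟨C, hC, h⟩ := hy
  obtain ⟨D, hD, h'⟩ := hz
  refine ⟨C + D, add_nonneg hC hD, fun N => ?_⟩
  rw [add_smul]
  refine le_trans ?_ ((abs_add_le _ _).trans (add_le_add (h N) (h' N)))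
  simp only [add_smul, Finset.sum_add_distrib]
  rw [add_sub_add_comm]

lemma IsOrderSum.smul {d : ℕ → X} {e : X} {a : ℕ → ℝ} {y : X} (hy : IsOrderSum d e a y) (c : ℝ) :
    IsOrderSum d e (fun n => c * a n) (c • y) := by
  obtain ⟨C, hC, h⟩ := hy
  refine ⟨|c| * C, by positivity, fun N => ?_⟩
  simp only [mul_smul, ← Finset.smul_sum]
  rw [← smul_sub, abs_smul_eq]
  exact smul_le_smul_of_nonneg_left (h N) (abs_nonneg c)

lemma IsOrderSum.sub {d : ℕ → X} {e : X} {a b : ℕ → ℝ} {y z : X} (hy : IsOrderSum d e a y)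
    (hz : IsOrderSum d e b z) : IsOrderSum d e (fun n => a n - b n) (y - z) := by
  simpa [sub_eq_add_neg] using hy.add (hz.smul (-1))

lemma DisjointSeq.abs_sum {d : ℕ → X} (hd : DisjointSeq d) (a : ℕ → ℝ) (N : ℕ) :
    |∑ n ∈ Finset.range N, a n • d n| = ∑ n ∈ Finset.range N, |a n| • d n := by
  have habs : ∀ n, |a n • d n| = |a n| • d n := fun n => by
    rw [abs_smul_eq, abs_of_nonneg (hd.nonneg n)]
  have hdisj : ∀ N m, N ≤ m → d m ⊓ ∑ n ∈ Finset.range N, |a n| • d n = 0 := by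
    intro N
    induction N with
    | zero => intro m _; simpa using hd.nonneg m
    | succ N ih =>
      intro m hm
      rw [Finset.sum_range_succ]
      refine disjoint_add (hd.nonneg m)
        (Finset.sum_nonneg fun n _ => smul_nonneg (abs_nonneg _) (hd.nonneg n))
        (smul_nonneg (abs_nonneg _) (hd.nonneg N)) (ih m (by omega)) ?_
      rw [inf_comm]
      exact disjoint_smul (hd.nonneg N) (hd.nonneg m) (hd.disj N m (by omega)) (abs_nonneg _)
  induction N with
  | zero => simp
  | succ N ih =>
    rw [Finset.sum_range_succ, Finset.sum_range_succ, abs_add_of_disjoint, ih, habs]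
    rw [ih, habs, inf_comm]
    exact disjoint_smul (hd.nonneg N)
      (Finset.sum_nonneg fun n _ => smul_nonneg (abs_nonneg _) (hd.nonneg n))
      (hdisj N N le_rfl) (abs_nonneg _)

lemma IsOrderSum.abs {d : ℕ → X} (hd : DisjointSeq d) {e : X} {a : ℕ → ℝ} {y : X}
    (hy : IsOrderSum d e a y) : IsOrderSum d e (fun n => |a n|) |y| := by
  obtain ⟨C, hC, h⟩ := hy
  refine ⟨C, hC, fun N => ?_⟩
  rw [← hd.abs_sum]
  exact (abs_abs_sub_abs_le _ _).trans (h N)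

lemma IsOrderSum.sup {d : ℕ → X} (hd : DisjointSeq d) {e : X} {a b : ℕ → ℝ} {y z : X}
    (hy : IsOrderSum d e a y) (hz : IsOrderSum d e b z) :
    IsOrderSum d e (fun n => a n ⊔ b n) (y ⊔ z) := by
  simp only [sup_eq_half_smul_add_add_abs_sub' ℝ]
  exact ((hy.add hz).add ((hz.sub hy).abs hd)).smul 2⁻¹

lemma IsOrderSum.inf {d : ℕ → X} (hd : DisjointSeq d) {e : X} {a b : ℕ → ℝ} {y z : X}
    (hy : IsOrderSum d e a y) (hz : IsOrderSum d e b z) :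
    IsOrderSum d e (fun n => a n ⊓ b n) (y ⊓ z) := by
  simp only [inf_eq_half_smul_add_sub_abs_sub' ℝ]
  exact ((hy.add hz).sub ((hz.sub hy).abs hd)).smul 2⁻¹

lemma IsOrderSum.le {d : ℕ → X} {e : X} (he : IsLUB (Set.range fun N => ∑ n ∈ Finset.range N, d n) e)
    {a : ℕ → ℝ} {y z : X} (hy : IsOrderSum d e a y)
    (h : ∀ N, ∑ n ∈ Finset.range N, a n • d n ≤ z) : y ≤ z := by
  obtain ⟨C, hC, hy⟩ := hy
  refine le_add_of_isGLB (isLUB_range_sub he) hC fun N => ?_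
  have h1 := (le_abs_self _).trans (hy N)
  rw [sub_le_iff_le_add'] at h1
  exact h1.trans (add_le_add_left (h N) _)

lemma IsOrderSum.ge {d : ℕ → X} {e : X} (he : IsLUB (Set.range fun N => ∑ n ∈ Finset.range N, d n) e)
    {a : ℕ → ℝ} {y : X} (hy : IsOrderSum d e a y) (ha : ∀ n, 0 ≤ a n) (hd : DisjointSeq d) (k : ℕ) :
    a k • d k ≤ y := by
  obtain ⟨C, hC, hy⟩ := hy
  have hr := isLUB_range_sub he
  -- Only remainders past index `k` are used, so that each partial sum contains the term `a k • d
  -- k`.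
  have hr' : IsGLB (Set.range fun N => e - ∑ n ∈ Finset.range (N + (k + 1)), d n) 0 := by
    refine ⟨?_, fun z hz => hr.2 ?_⟩
    · rintro _ ⟨N, rfl⟩; exact hr.1 ⟨_, rfl⟩
    · rintro _ ⟨N, rfl⟩
      exact (hz ⟨N, rfl⟩).trans (sub_le_sub_left (hd.sum_mono (by omega)) _)
  refine le_add_of_isGLB hr' hC fun N => ?_
  have h1 := (neg_le_abs _).trans (hy (N + (k + 1)))
  rw [neg_sub, sub_le_iff_le_add'] at h1
  refine le_trans ?_ h1
  exact Finset.single_le_sum (f := fun n => a n • d n)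
    (fun n _ => smul_nonneg (ha n) (hd.nonneg n)) (Finset.mem_range.2 (by omega))

lemma IsOrderSum.unique {d : ℕ → X} {e : X}
    (he : IsLUB (Set.range fun N => ∑ n ∈ Finset.range N, d n) e)
    {a : ℕ → ℝ} {y z : X} (hy : IsOrderSum d e a y) (hz : IsOrderSum d e a z) : y = z := by
  have key : ∀ y z : X, IsOrderSum d e a y → IsOrderSum d e a z → y ≤ z := fun y z hy hz =>
    sub_nonpos.1 ((hy.sub hz).le he (by simp))
  exact le_antisymm (key y z hy hz) (key z y hz hy)

lemma exists_isOrderSum_of_nonneg (hX : IsSigmaDedekindComplete X) {d : ℕ → X} (hd : DisjointSeq d)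
    {e : X} (he : IsLUB (Set.range fun N => ∑ n ∈ Finset.range N, d n) e) {a : ℕ → ℝ}
    (ha : ∀ n, 0 ≤ a n) {M : ℝ} (hM : ∀ n, a n ≤ M) : ∃ y, IsOrderSum d e a y := by
  have hM0 : 0 ≤ M := (ha 0).trans (hM 0)
  have hmono : Monotone fun N => ∑ n ∈ Finset.range N, a n • d n := monotone_nat_of_le_succ fun n => by
    rw [Finset.sum_range_succ]; exact le_add_of_nonneg_right (smul_nonneg (ha n) (hd.nonneg n))
  have hdiff : Monotone fun N => ∑ n ∈ Finset.range N, (M - a n) • d n :=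
    monotone_nat_of_le_succ fun n => by
      rw [Finset.sum_range_succ]
      exact le_add_of_nonneg_right (smul_nonneg (sub_nonneg.2 (hM n)) (hd.nonneg n))
  -- The partial sums with coefficients `M - a n` also increase, so the growth of the `a`-sums past
  -- `N` is at most `M` times that of the `d`-sums.
  have hbound : ∀ N K, ∑ n ∈ Finset.range K, a n • d n ≤
      ∑ n ∈ Finset.range N, a n • d n + M • (e - ∑ n ∈ Finset.range N, d n) := fun N K => by
    refine (hmono (le_max_left K N)).trans ?_
    have h1 := hdiff (le_max_right K N)
    have h2 : M • ∑ n ∈ Finset.range (max K N), d n ≤ M • e :=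
      smul_le_smul_of_nonneg_left (he.1 ⟨_, rfl⟩) hM0
    simp only [sub_smul, Finset.sum_sub_distrib, ← Finset.smul_sum] at h1
    exact le_of_le_of_sub_eq (add_le_add h1 h2) (by module)
  obtain ⟨y, hy⟩ := exists_isLUB_of_isSigmaDedekindComplete hX _ _ (hbound 0)
  refine ⟨y, M, hM0, fun N => ?_⟩
  rw [abs_of_nonneg (sub_nonneg.2 (hy.1 ⟨N, rfl⟩)), sub_le_iff_le_add']
  exact hy.2 (by rintro _ ⟨K, rfl⟩; exact hbound N K)

lemma exists_isOrderSum (hX : IsSigmaDedekindComplete X) {d : ℕ → X} (hd : DisjointSeq d)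
    {e : X} (he : IsLUB (Set.range fun N => ∑ n ∈ Finset.range N, d n) e) {a : ℕ → ℝ}
    {M : ℝ} (hM : ∀ n, |a n| ≤ M) : ∃ y, IsOrderSum d e a y := by
  obtain ⟨y, hy⟩ := exists_isOrderSum_of_nonneg hX hd he (a := fun n => a n + M) (M := M + M)
    (fun n => by linarith [neg_abs_le (a n), hM n]) (fun n => by linarith [le_abs_self (a n), hM n])
  obtain ⟨z, hz⟩ := exists_isOrderSum_of_nonneg hX hd he (a := fun _ => M) (M := M)
    (fun n => (abs_nonneg _).trans (hM n)) (fun n => le_rfl)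
  exact ⟨y - z, by simpa using hy.sub hz⟩

end OrderSum

/-! ### Embedding `ℓ_∞`. -/

section Copy

variable {X : Type*} [NormedAddCommGroup X] [NormedSpace ℝ X] [Lattice X] [IsOrderedAddMonoid X]
  [IsOrderedModule ℝ X] [HasSolidNorm X]

/-- An order bounded disjoint sequence with asymptotically maximal norms spans a copy of `ℓ_∞`. -/
lemma containsCopy_of_disjointSeq (hX : IsSigmaDedekindComplete X) {d : ℕ → X} (hd : DisjointSeq d)
    {x : X} (hdx : ∀ n, d n ≤ x) (hx : ‖x‖ ≤ 1) (hlim : Tendsto (fun n => ‖d n‖) atTop (𝓝 1)) :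
    ContainsLatticeIsometricCopyOfEllInfty X := by
  have hPx := hd.sum_le ((hd.nonneg 0).trans (hdx 0)) hdx
  obtain ⟨e, he⟩ := exists_isLUB_of_isSigmaDedekindComplete hX _ _ hPx
  have hex : e ≤ x := he.2 (by rintro _ ⟨N, rfl⟩; exact hPx N)
  have he0 : 0 ≤ e := by simpa using he.1 ⟨0, rfl⟩
  have hex1 : ‖e‖ ≤ 1 := (norm_le_norm_of_nonneg_of_le he0 hex).trans hx
  -- Unpairing gives each coordinate `k` infinitely many indices, so `‖T a‖ ≥ |a k| * ‖d n‖` along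
  -- norms tending to `1`.
  let c : lp (fun _ : ℕ => ℝ) ∞ → ℕ → ℝ := fun a n => a n.unpair.1
  have hc : ∀ a n, |c a n| ≤ ‖a‖ := fun a n => by
    simpa using lp.norm_apply_le_norm (by simp) a n.unpair.1
  choose T hT using fun a => exists_isOrderSum hX hd he (hc a)
  have hnorm : ∀ a, ‖T a‖ = ‖a‖ := fun a => by
    have habs := (hT a).abs hd
    refine le_antisymm ?_ (lp.norm_le_of_forall_le (norm_nonneg _) fun k => ?_)
    · have h1 : |T a| ≤ ‖a‖ • e := habs.le he fun N => by
        calc ∑ n ∈ Finset.range N, |c a n| • d n ≤ ∑ n ∈ Finset.range N, ‖a‖ • d n :=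
              Finset.sum_le_sum fun n _ => smul_le_smul_of_nonneg_right (hc a n) (hd.nonneg n)
          _ = ‖a‖ • ∑ n ∈ Finset.range N, d n := Finset.smul_sum.symm
          _ ≤ ‖a‖ • e := smul_le_smul_of_nonneg_left (he.1 ⟨N, rfl⟩) (norm_nonneg a)
      have h2 := norm_le_norm_of_nonneg_of_le (abs_nonneg _) h1
      rw [norm_abs_eq_norm, norm_smul, norm_norm] at h2
      exact h2.trans (mul_le_of_le_one_right (norm_nonneg a) hex1)
    · have hpair : Tendsto (fun i => Nat.pair k i) atTop atTop :=
        tendsto_atTop_mono (fun i => Nat.right_le_pair k i) tendsto_id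
      have h1 := (hlim.comp hpair).const_mul |a k|
      rw [mul_one] at h1
      refine le_of_tendsto' h1 fun i => ?_
      have h2 := habs.ge he (fun n => abs_nonneg _) hd (Nat.pair k i)
      simp only [c, Nat.unpair_pair] at h2
      have h3 := norm_le_norm_of_nonneg_of_le (smul_nonneg (abs_nonneg _) (hd.nonneg _)) h2
      rwa [norm_abs_eq_norm, norm_smul, Real.norm_eq_abs, abs_abs] at h3
  let L : lp (fun _ : ℕ => ℝ) ∞ →ₗ[ℝ] X :=
    { toFun := T
      map_add' := fun a b => (hT (a + b)).unique he (by simpa [c] using (hT a).add (hT b))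
      map_smul' := fun r a => (hT (r • a)).unique he (by simpa [c] using (hT a).smul r) }
  refine ⟨⟨L, hnorm⟩, fun a b m => ⟨fun h => ?_, fun h => ?_⟩⟩
  · refine (hT m).unique he ?_
    have := (hT a).sup hd (hT b)
    have hcm : c m = fun n => c a n ⊔ c b n := funext fun n => h _
    rwa [hcm]
  · refine (hT m).unique he ?_
    have := (hT a).inf hd (hT b)
    have hcm : c m = fun n => c a n ⊓ c b n := funext fun n => h _
    rwa [hcm]

end Copy

/-! ### Band projections and components. -/

section Component

variable {X : Type*} [AddCommGroup X] [Lattice X] [IsOrderedAddMonoid X] [Module ℝ X]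
  [IsOrderedModule ℝ X]

/-- The projection of `x` onto the band generated by `v` is a component of `x`. -/
lemma inf_sub_eq_zero_of_isLUB {v x u : X} (hx : 0 ≤ x)
    (hu : IsLUB (Set.range fun k : ℕ => (k : ℝ) • v ⊓ x) u) : u ⊓ (x - u) = 0 := by
  have hs0 : 0 ≤ u := by simpa [hx] using hu.1 ⟨0, rfl⟩
  have hux : u ≤ x := hu.2 (by rintro _ ⟨k, rfl⟩; exact inf_le_right)
  have hdouble : (2 : ℝ) • u ⊓ x ≤ u := by
    -- For each `s` in the family, add `2s ⊓ x ≤ u` and `2u ⊓ x - 2s ⊓ x ≤ 2u - 2s`, then take the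
    -- supremum over `s`.
    have h1 : u ≤ (2⁻¹ : ℝ) • ((3 : ℝ) • u - (2 : ℝ) • u ⊓ x) := hu.2 (by
      rintro _ ⟨k, rfl⟩
      set s := (k : ℝ) • v ⊓ x
      have hsu : s ≤ u := hu.1 ⟨k, rfl⟩
      have h2 : (2 : ℝ) • s ⊓ x ≤ u := by
        refine le_trans (inf_le_inf_right x ?_) (hu.1 ⟨2 * k, rfl⟩)
        push_cast
        rw [mul_smul]
        exact smul_le_smul_of_nonneg_left inf_le_left (by norm_num)
      have h3 := inf_sub_inf_le (smul_le_smul_of_nonneg_left hsu (zero_le_two (α := ℝ))) x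
      rw [inf_comm x, inf_comm x] at h3
      rw [le_inv_smul_iff_of_pos two_pos]
      exact le_of_le_of_sub_eq (add_le_add h2 h3) (by module))
    rw [le_inv_smul_iff_of_pos two_pos] at h1
    exact le_of_le_of_sub_eq h1 (by module)
  refine le_antisymm ?_ (le_inf hs0 (sub_nonneg.2 hux))
  have : u ⊓ (x - u) = (2 : ℝ) • u ⊓ x - u := by rw [inf_sub]; congr 1; module
  rw [this]
  exact sub_nonpos.2 hdouble

/-- An increasing sequence with supremum `x` can be replaced by a sequence of components of `x`. -/
lemma exists_components (hX : IsSigmaDedekindComplete X) {x : X} {w : ℕ → X} (hw : Monotone w)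
    (hw0 : ∀ n, 0 ≤ w n) (hwx : IsLUB (Set.range w) x) :
    ∃ u : ℕ → X, Monotone u ∧ (∀ n, 0 ≤ u n) ∧ (∀ n, u n ≤ (2 : ℝ) • w n) ∧
      IsLUB (Set.range u) x ∧ ∀ n, u n ⊓ (x - u n) = 0 := by
  have hle : ∀ n, w n ≤ x := fun n => hwx.1 ⟨n, rfl⟩
  have hx : 0 ≤ x := (hw0 0).trans (hle 0)
  -- The band of `(2w - x)⁺` is where `w` exceeds `x / 2`: there `x ≤ 2w`, which keeps the component
  -- below `2w`.
  set v : ℕ → X := fun n => ((2 : ℝ) • w n - x)⁺ with hv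
  have hv0 : ∀ n, 0 ≤ v n := fun n => posPart_nonneg _
  have hvm : Monotone v := fun m n h =>
    posPart_mono (sub_le_sub_right (smul_le_smul_of_nonneg_left (hw h) zero_le_two) _)
  choose u hu using fun n => exists_isLUB_of_isSigmaDedekindComplete hX
    (fun k : ℕ => (k : ℝ) • v n ⊓ x) x fun k => inf_le_right
  have hux : ∀ n, u n ≤ x := fun n => (hu n).2 (by rintro _ ⟨k, rfl⟩; exact inf_le_right)
  refine ⟨u, fun m n h => (hu m).2 ?_, fun n => ?_, fun n => (hu n).2 ?_, ⟨?_, fun z hz => ?_⟩,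
    fun n => inf_sub_eq_zero_of_isLUB hx (hu n)⟩
  · rintro _ ⟨k, rfl⟩
    exact (inf_le_inf_right x (smul_le_smul_of_nonneg_left (hvm h) k.cast_nonneg)).trans
      ((hu n).1 ⟨k, rfl⟩)
  · simpa [hx] using (hu n).1 ⟨0, rfl⟩
  · rintro _ ⟨k, rfl⟩
    have h1 : ((k : ℝ) • v n) ⊓ ((2 : ℝ) • w n - x)⁻ = 0 :=
      disjoint_smul (hv0 n) (negPart_nonneg _) (posPart_inf_negPart_eq_zero _) k.cast_nonneg
    rw [← sub_nonpos, inf_sub, ← h1]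
    refine inf_le_inf (sub_le_self _ (smul_nonneg zero_le_two (hw0 n))) ?_
    rw [← neg_sub]
    exact neg_le_negPart _
  · rintro _ ⟨n, rfl⟩; exact hux n
  -- From `2 w n - x ≤ v n ⊓ x ≤ u n ≤ z` follows `w n ≤ (z + x) / 2`; the supremum over `n` gives
  -- `x ≤ z`.
  · have h1 : x ≤ (2⁻¹ : ℝ) • (z + x) := hwx.2 (by
      rintro _ ⟨n, rfl⟩
      rw [le_inv_smul_iff_of_pos two_pos, ← sub_le_iff_le_add]
      have h2 : v n ⊓ x ≤ u n := by simpa using (hu n).1 ⟨1, rfl⟩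
      refine le_trans (le_inf (le_posPart _) ?_) (h2.trans (hz ⟨n, rfl⟩))
      exact le_of_le_of_sub_eq (add_le_add (hle n) (hle n)) (by module))
    rw [le_inv_smul_iff_of_pos two_pos] at h1
    exact le_of_le_of_sub_eq h1 (by module)

end Component

/-! ### From a singular functional to a copy of `ℓ_∞`. -/

section Backward

variable {X : Type*} [NormedAddCommGroup X] [NormedSpace ℝ X] [Lattice X] [IsOrderedAddMonoid X]
  [IsOrderedModule ℝ X] [HasSolidNorm X]

/-- For an upper bound `z`, the defect `w = x - z ⊓ x` is disjoint from `X_a`: if `v = w ⊓ |y|` and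
`k • v ≤ x`, then `k • v ≤ z ⊓ x`, so `(k + 1) • v ≤ x`; boundedness in norm forces `v = 0`. By
(iii), `w` is then disjoint from itself. -/
lemma isLUB_orderContinuous
    (hband : disjointComplement (disjointComplement (orderContinuousPart X)) = Set.univ)
    {x : X} (hx : 0 ≤ x) :
    IsLUB {y : X | IsOrderContinuousElement y ∧ 0 ≤ y ∧ y ≤ x} x := by
  refine ⟨fun y hy => hy.2.2, fun z hz => ?_⟩
  set w := x - z ⊓ x
  have hw0 : 0 ≤ w := sub_nonneg.2 inf_le_right
  have hA : ∀ y, IsOrderContinuousElement y → w ⊓ |y| = 0 := by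
    intro y hy
    set v := w ⊓ |y|
    have hv0 : 0 ≤ v := le_inf hw0 (abs_nonneg y)
    have hv : IsOrderContinuousElement v := hy.mono (by rw [abs_of_nonneg hv0]; exact inf_le_right)
    have hk : ∀ k : ℕ, (k : ℝ) • v ≤ x := by
      intro k
      induction k with
      | zero => simpa using hx
      | succ k ih =>
        have h1 : (k : ℝ) • v ≤ z ⊓ x :=
          le_inf (hz ⟨hv.smul _, smul_nonneg k.cast_nonneg hv0, ih⟩) ih
        have h2 : v ≤ x - z ⊓ x := inf_le_left
        push_cast
        exact le_of_le_of_sub_eq (add_le_add h1 h2) (by module)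
    have hkn : ∀ k : ℕ, k * ‖v‖ ≤ ‖x‖ := fun k => by
      have := norm_le_norm_of_nonneg_of_le (smul_nonneg k.cast_nonneg hv0) (hk k)
      simpa [norm_smul] using this
    by_contra hne
    obtain ⟨k, hk'⟩ := exists_nat_gt (‖x‖ / ‖v‖)
    have hvpos : 0 < ‖v‖ := norm_pos_iff.2 hne
    rw [div_lt_iff₀ hvpos] at hk'
    exact absurd (hkn k) (not_le.2 hk')
  have hwd : w ∈ disjointComplement (orderContinuousPart X) := fun y hy => by
    rw [abs_of_nonneg hw0]; exact hA y hy
  have hww : w ∈ disjointComplement (disjointComplement (orderContinuousPart X)) :=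
    hband ▸ Set.mem_univ w
  have h0 := hww w hwd
  rw [inf_idem, abs_of_nonneg hw0] at h0
  exact (sub_eq_zero.1 h0).le.trans inf_le_left

lemma exists_seq_orderContinuous (hsuper : IsSuperSigmaDedekindComplete X)
    (hband : disjointComplement (disjointComplement (orderContinuousPart X)) = Set.univ)
    {x : X} (hx : 0 ≤ x) :
    ∃ w : ℕ → X, Monotone w ∧ (∀ n, 0 ≤ w n) ∧ (∀ n, IsOrderContinuousElement (w n)) ∧
      IsLUB (Set.range w) x := by
  obtain ⟨C, hCA, hC, hCx⟩ := hsuper.2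
    {y : X | IsOrderContinuousElement y ∧ 0 ≤ y ∧ y ≤ x} x
    ⟨0, isOrderContinuousElement_zero, le_rfl, hx⟩ (isLUB_orderContinuous hband hx)
  -- `C` may be empty; adjoining `0` allows an enumeration.
  obtain ⟨f, hf⟩ := (hC.insert 0).exists_eq_range (Set.insert_nonempty 0 C)
  have hfA : ∀ n, IsOrderContinuousElement (f n) ∧ 0 ≤ f n ∧ f n ≤ x := fun n => by
    rcases (hf ▸ Set.mem_range_self n : f n ∈ insert 0 C) with h | h
    · rw [h]; exact ⟨isOrderContinuousElement_zero, le_rfl, hx⟩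
    · exact hCA h
  have hpos : ∀ n, 0 ≤ partialSups f n := fun n => (hfA n).2.1.trans (le_partialSups f n)
  refine ⟨partialSups f, (partialSups f).monotone, hpos, fun n => ?_, ?_, fun z hz => ?_⟩
  · induction n with
    | zero => simpa using (hfA 0).1
    | succ n ih =>
      refine (ih.add (hfA (n + 1)).1).mono ?_
      rw [abs_of_nonneg (hpos _), abs_of_nonneg (add_nonneg (hpos n) (hfA _).2.1),
        partialSups_add_one]
      exact sup_le (le_add_of_nonneg_right (hfA _).2.1) (le_add_of_nonneg_left (hpos n))
  · rintro _ ⟨n, rfl⟩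
    exact partialSups_le f n x fun k _ => (hfA k).2.2
  · refine hCx.2 fun c hc => ?_
    obtain ⟨n, rfl⟩ : c ∈ Set.range f := hf ▸ Set.mem_insert_of_mem 0 hc
    exact (le_partialSups f n).trans (hz ⟨n, rfl⟩)

/-- If `S` is singular and attains its norm at `f`, then `|f|` is at distance `‖f‖ = 1` from the
order continuous elements below it. -/
lemma norm_abs_sub_eq_one {S : StrongDual ℝ X} (hS0 : S ≠ 0) (hS : IsSingularFunctional S) {f : X}
    (hf : ‖f‖ ≤ 1) (hSf : S f = ‖S‖) {u : X} (hu : IsOrderContinuousElement u) (hu0 : 0 ≤ u)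
    (huf : u ≤ |f|) : ‖|f| - u‖ = 1 := by
  refine le_antisymm ?_ ?_
  · refine le_trans ?_ ((norm_abs_eq_norm f).le.trans hf)
    exact norm_le_norm_of_nonneg_of_le (sub_nonneg.2 huf) (sub_le_self _ hu0)
  -- `y` gives `u` the signs of `f`, so that `|f - y| ≤ |f| - u`, while `S (f - y) = ‖S‖`.
  · set y := u ⊓ f⁺ - u ⊓ f⁻
    have hp : 0 ≤ u ⊓ f⁺ := le_inf hu0 (posPart_nonneg f)
    have hn : 0 ≤ u ⊓ f⁻ := le_inf hu0 (negPart_nonneg f)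
    have hy : IsOrderContinuousElement y := by
      refine hu.mono ?_
      rw [abs_of_nonneg hu0, abs_le', neg_sub]
      exact ⟨(sub_le_self _ hn).trans inf_le_left, (sub_le_self _ hp).trans inf_le_left⟩
    have hpn : f⁺ ⊓ f⁻ = 0 := posPart_inf_negPart_eq_zero f
    have hle : |f - y| ≤ |f| - u := by
      have h1 : f - y = (f⁺ - u ⊓ f⁺) - (f⁻ - u ⊓ f⁻) := by
        conv_lhs => rw [← posPart_sub_negPart f]
        simp only [y]; abel
      have h2 : u ≤ u ⊓ f⁺ + u ⊓ f⁻ := by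
        have := inf_add_le hu0 (posPart_nonneg f) (negPart_nonneg f)
        rwa [posPart_add_negPart, inf_eq_left.2 huf] at this
      have ha : 0 ≤ f⁺ - u ⊓ f⁺ := sub_nonneg.2 inf_le_right
      have hb : 0 ≤ f⁻ - u ⊓ f⁻ := sub_nonneg.2 inf_le_right
      have h3 : |f - y| ≤ (f⁺ - u ⊓ f⁺) + (f⁻ - u ⊓ f⁻) := by
        rw [h1, abs_le', neg_sub]
        exact ⟨(sub_le_self _ hb).trans (le_add_of_nonneg_right hb),
          (sub_le_self _ ha).trans (le_add_of_nonneg_left ha)⟩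
      refine h3.trans ?_
      rw [← posPart_add_negPart f]
      exact le_of_le_of_sub_eq h2 (by abel)
    have hSn : 0 < ‖S‖ := norm_pos_iff.2 hS0
    have h4 : ‖S‖ ≤ ‖S‖ * ‖f - y‖ := by
      have := (le_abs_self _).trans (S.le_opNorm (f - y))
      rwa [map_sub, hS y hy, sub_zero, hSf] at this
    have h5 : 1 ≤ ‖f - y‖ := by
      by_contra! hlt
      nlinarith
    refine h5.trans (norm_le_norm_of_abs_le_abs ?_)
    rwa [abs_of_nonneg (sub_nonneg.2 huf)]

/-- Differences of a suitable subsequence of components form a disjoint sequence with norms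
tending to one. -/
lemma exists_disjointSeq (hfatou : HasSemiFatouProperty X) {x : X} {u : ℕ → X} (hu : Monotone u)
    (hu0 : ∀ n, 0 ≤ u n) (hux : IsLUB (Set.range u) x) (hcomp : ∀ n, u n ⊓ (x - u n) = 0)
    (hnorm : ∀ n, ‖x - u n‖ = 1) :
    ∃ d : ℕ → X, DisjointSeq d ∧ (∀ n, d n ≤ x) ∧ Tendsto (fun n => ‖d n‖) atTop (𝓝 1) := by
  have hle : ∀ n, u n ≤ x := fun n => hux.1 ⟨n, rfl⟩
  have hnext : ∀ n k : ℕ, ∃ m, n ≤ m ∧ 1 - 1 / ((k : ℝ) + 1) < ‖u m - u n‖ := by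
    intro n k
    have hlub : IsLUB (Set.range fun i => u (n + i) - u n) (x - u n) := by
      refine ⟨?_, fun z hz => ?_⟩
      · rintro _ ⟨i, rfl⟩; exact sub_le_sub_right (hle _) _
      · rw [sub_le_iff_le_add]
        refine hux.2 ?_
        rintro _ ⟨i, rfl⟩
        have h1 : u (n + i) - u n ≤ z := hz ⟨i, rfl⟩
        exact (hu (Nat.le_add_left i n)).trans (sub_le_iff_le_add.1 h1)
    have hlim := hfatou _ _ (fun i => sub_nonneg.2 (hu (Nat.le_add_right n i)))
      (fun i j h => sub_le_sub_right (hu (by omega)) _) hlub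
    rw [hnorm] at hlim
    have hpos : (0 : ℝ) < 1 / ((k : ℝ) + 1) := by positivity
    obtain ⟨i, hi⟩ := (hlim.eventually (lt_mem_nhds (sub_lt_self 1 hpos))).exists
    exact ⟨n + i, Nat.le_add_right n i, hi⟩
  choose g hg1 hg2 using hnext
  let p : ℕ → ℕ := fun k => Nat.rec 0 (fun k n => g n k) k
  have hp : ∀ k, p (k + 1) = g (p k) k := fun k => rfl
  have hpm : Monotone p := monotone_nat_of_le_succ fun k => hp k ▸ hg1 _ _
  have hd0 : ∀ k, 0 ≤ u (p (k + 1)) - u (p k) := fun k => sub_nonneg.2 (hu (hpm (Nat.le_succ k)))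
  refine ⟨fun k => u (p (k + 1)) - u (p k), ⟨hd0, fun m n hmn => ?_⟩,
    fun k => (sub_le_self _ (hu0 _)).trans (hle _), ?_⟩
  -- The earlier difference lies below the component `u (p (m + 1))`, the later one below its
  -- complement in `x`.
  · exact disjoint_mono (hd0 m) (hd0 n) (sub_le_self _ (hu0 _))
      (sub_le_sub (hle _) (hu (hpm hmn))) (hcomp (p (m + 1)))
  · have hlow : Tendsto (fun k : ℕ => 1 - 1 / ((k : ℝ) + 1)) atTop (𝓝 1) := by
      simpa using tendsto_one_div_add_atTop_nhds_zero_nat.const_sub (1 : ℝ)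
    refine tendsto_of_tendsto_of_tendsto_of_le_of_le hlow tendsto_const_nhds
      (fun k => (hg2 (p k) k).le) fun k => ?_
    rw [← hnorm (p k)]
    exact norm_le_norm_of_nonneg_of_le (hd0 k) (sub_le_sub_right (hle _) _)

lemma containsCopy_of_singular (hsuper : IsSuperSigmaDedekindComplete X)
    (hfatou : HasSemiFatouProperty X)
    (hband : disjointComplement (disjointComplement (orderContinuousPart X)) = Set.univ)
    {S : StrongDual ℝ X} (hS0 : S ≠ 0) (hS : IsSingularFunctional S) (hSa : AttainsNorm S) :
    ContainsLatticeIsometricCopyOfEllInfty X := by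
  obtain ⟨f, hf, hSf⟩ := hSa
  obtain ⟨w, hw, hw0, hwc, hwx⟩ := exists_seq_orderContinuous hsuper hband (abs_nonneg f)
  obtain ⟨u, hu, hu0, huw, hux, hcomp⟩ := exists_components hsuper.1 hw hw0 hwx
  have huc : ∀ n, IsOrderContinuousElement (u n) := fun n => ((hwc n).smul 2).mono (by
    rw [abs_of_nonneg (hu0 n), abs_of_nonneg (smul_nonneg zero_le_two (hw0 n))]
    exact huw n)
  obtain ⟨d, hd, hdx, hlim⟩ := exists_disjointSeq hfatou hu hu0 hux hcomp fun n =>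
    norm_abs_sub_eq_one hS0 hS hf hSf (huc n) (hu0 n) (hux.1 ⟨n, rfl⟩)
  exact containsCopy_of_disjointSeq hsuper.1 hd hdx ((norm_abs_eq_norm f).le.trans hf) hlim

end Backward

end BanachLattice

theorem mainTheorem12 {X : Type*} [NormedAddCommGroup X] [NormedSpace ℝ X] [CompleteSpace X]
    [Lattice X] [IsOrderedAddMonoid X] [IsOrderedModule ℝ X] [HasSolidNorm X]
    (hsuper : BanachLattice.IsSuperSigmaDedekindComplete X)
    (hfatou : BanachLattice.HasSemiFatouProperty X)
    (hband : BanachLattice.disjointComplement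
      (BanachLattice.disjointComplement (BanachLattice.orderContinuousPart X)) = Set.univ) :
    BanachLattice.ContainsLatticeIsometricCopyOfEllInfty X ↔
      ∃ S : StrongDual ℝ X, S ≠ 0 ∧ BanachLattice.IsSingularFunctional S ∧
        BanachLattice.AttainsNorm S := by
  exact ⟨BanachLattice.exists_singular_of_containsCopy hsuper.1, fun ⟨_, hS0, hS, hSa⟩ =>
    BanachLattice.containsCopy_of_singular hsuper hfatou hband hS0 hS hSa⟩
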